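/- Let $K$ be a field of characteristic zero. For a finite-dimensional Lie algebra $\mathfrak{g}$ over $K$ and a linear form $\ell\in\mathfrak{g}^*$ let $\mathfrak{g}(\ell)=\{y\in\mathfrak{g}\mid \ell([x,y])=0 \text{ for all } x\in\mathfrak{g}\}$, and define the index of $\mathfrak{g}$ by $\chi(\mathfrak{g})=\inf\{\dim\mathfrak{g}(\ell)\mid \ell\in\mathfrak{g}^*\}$. Let $F_{g}$ be the free Lie algebra over $K$ on generators $x_1,\dots,x_g$, with lower central series $F_g^1=F_g$, $F_g^{k+1}=[F_g,F_g^k]$, and let $F_{g,3}=F_g/F_g^{4}$ be the free-nilpotent Lie algebra of class $3$ on $g$ generators, whose center is denoted by $Z(F_{g,3})$. We write $x_i$ also for the image of the generator $x_i$ in $F_{g,3}$. **Theorem.** For every $g\ge 3$ the Lie algebra $F_{g,3}$ is finite-dimensional and $$\chi(F_{g,3})=\dim Z(F_{g,3})+\binom{g}{2}-g=\dim F_{g,3}-2g=\frac{2g^3+3g^2-11g}{6}.$$ Moreover, there is a linear form $\ell\in F_{g,3}^*$ with $\ell(x_i)=0$ and $\ell([x_i,x_j])=0$ for all $1\le i,j\le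 g$, and $\ell([x_i,[x_j,x_k]])=i+j+k$ for all $1\le j<k\le g$ and $1\le i\le k$, and it attains the infimum: $\dim F_{g,3}(\ell)=\chi(F_{g,3})$. -/

import Mathlib

noncomputable section

namespace NilpotentIndex

/-- The radical `𝔤(ℓ) = {y ∈ 𝔤 | ℓ([x, y]) = 0 for all x ∈ 𝔤}` of the skew-symmetric bilinear form
`B_ℓ(x, y) = ℓ([x, y])` attached to a linear form `ℓ ∈ 𝔤*`, as a Lie subalgebra of `𝔤`. -/
def radical {K L : Type*} [Field K] [LieRing L] [LieAlgebra K L] (l : Module.Dual K L) :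
    LieSubalgebra K L where
  carrier := {y | ∀ x : L, l ⁅x, y⁆ = 0}
  zero_mem' := fun x => by simp
  add_mem' := fun {a b} ha hb x => by rw [lie_add, map_add, ha x, hb x, add_zero]
  smul_mem' := fun c a ha x => by rw [lie_smul, map_smul, ha x, smul_zero]
  lie_mem' := fun {a b} ha hb x => by
    rw [leibniz_lie, map_add, hb ⁅x, a⁆, ← lie_skew a ⁅x, b⁆, map_neg, ha ⁅x, b⁆, neg_zero, add_zero]

/-- The index `χ(𝔤) = inf {dim 𝔤(ℓ) | ℓ ∈ 𝔤*}` of a finite-dimensional Lie algebra `𝔤` over `K`. -/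
def index (K L : Type*) [Field K] [LieRing L] [LieAlgebra K L] : ℕ :=
  sInf (Set.range fun l : Module.Dual K L => Module.finrank K (radical l))

/-- The free-nilpotent Lie algebra `F_{g,c} = F_g / F_g^{c+1}` over `K`, with `g` generators and of
nilpotency class `c`. Here `F_g` is the free Lie algebra on `g` generators, and Mathlib numbers
the lower central series from `0`, so that its `c`-th term is `F_g^{c+1}`
(where `F_g^1 = F_g` and `F_g^{k+1} = [F_g, F_g^k]`). -/
abbrev FreeNilpotent (K : Type*) [Field K] (g c : ℕ) : Type _ :=
  FreeLieAlgebra K (Fin g) ⧸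
    LieModule.lowerCentralSeries K (FreeLieAlgebra K (Fin g)) (FreeLieAlgebra K (Fin g)) c

/-- The generators of `F_{g,c}` (numbered from `0`): the images of the free generators of `F_g`. -/
def gen (K : Type*) [Field K] (g c : ℕ) (i : Fin g) : FreeNilpotent K g c :=
  LieSubmodule.Quotient.mk (FreeLieAlgebra.of K i)

end NilpotentIndex

end

/-! In class three, commutators commute with each other, and modulo commutators an element z is
given by its g generator coordinates v(z). If v(z) = 0, the g equations ℓ([x_i, z]) = 0 already put
z in the radical, so the radical has codimension at most 2g for every ℓ (`ker_radicalMap_le`).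
Equality holds once Σ β_i ℓ([x_i, [x_j, x_k]]) = 0 for all j, k forces β = 0: this makes the 2g
equations necessary (`radical_le_ker_radicalMap`) and independent (`range_radicalMap`). For the
explicit ℓ it is an elementary linear system (`eq_zero_of_sum_mul_ite_eq_zero`).

Prescribing ℓ and counting dimensions needs a Hall basis. Jacobi gives spanning (`span_hall`);
independence comes from reading off coefficients of words of length at most three as entries of
strictly upper triangular matrices (`hallDual_hall_of_ne`). The same entries show that the center is
exactly the degree-three part (`center_freeNilpotent_three`). -/

noncomputable section

namespace NilpotentIndex

open Module

/-! ### Generation of the free Lie algebra -/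

section Generation

variable {K X : Type*} [CommRing K]

/-- A Lie subalgebra of a free Lie algebra that contains the generators is everything. -/
theorem freeLie_mem_of_generators (H : LieSubalgebra K (FreeLieAlgebra K X))
    (h : ∀ i, FreeLieAlgebra.of K i ∈ H) (x : FreeLieAlgebra K X) : x ∈ H := by
  -- By the universal property, the identity factors through the inclusion of `H`.
  have key : H.incl.comp (FreeLieAlgebra.lift K fun i => (⟨FreeLieAlgebra.of K i, h i⟩ : H)) =
      LieHom.id := by
    ext i
    simp
  have := congrArg (fun f : FreeLieAlgebra K X →ₗ⁅K⁆ FreeLieAlgebra K X => f x) key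
  simp only [LieHom.comp_apply, LieHom.id_apply] at this
  rw [← this]
  exact Subtype.property _

end Generation

/-! ### Strictly upper triangular representations -/

section Representation

attribute [local instance] LieRing.ofAssociativeRing

variable {K X : Type*} [CommRing K]

/-- The `4 × 4` matrices whose entries vanish below the `n`-th superdiagonal. -/
def upper (K : Type*) [CommRing K] (n : ℕ) : Submodule K (Matrix (Fin 4) (Fin 4) K) where
  carrier := {M | ∀ p q : Fin 4, (q : ℕ) < p + n → M p q = 0}
  zero_mem' := fun _ _ _ => rfl
  add_mem' := fun ha hb p q h => by rw [Matrix.add_apply, ha p q h, hb p q h, add_zero]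
  smul_mem' := fun c a ha p q h => by rw [Matrix.smul_apply, ha p q h, smul_zero]

theorem mul_mem_upper {m n : ℕ} {M N : Matrix (Fin 4) (Fin 4) K} (hM : M ∈ upper K m)
    (hN : N ∈ upper K n) : M * N ∈ upper K (m + n) := by
  intro p q h
  rw [Matrix.mul_apply]
  refine Finset.sum_eq_zero fun r _ => ?_
  by_cases hr : (r : ℕ) < p + m
  · rw [hM p r hr, zero_mul]
  · rw [hN r q (by omega), mul_zero]

theorem upper_antitone {m n : ℕ} (h : m ≤ n) : upper K n ≤ upper K m :=
  fun _ hM p q hq => hM p q (by omega)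

theorem eq_zero_of_mem_upper_four {M : Matrix (Fin 4) (Fin 4) K} (hM : M ∈ upper K 4) : M = 0 := by
  ext p q
  exact hM p q (by omega)

theorem lie_mem_upper {m n : ℕ} {M N : Matrix (Fin 4) (Fin 4) K} (hM : M ∈ upper K m)
    (hN : N ∈ upper K n) : ⁅M, N⁆ ∈ upper K (m + n) := by
  rw [Ring.lie_def]
  exact sub_mem (mul_mem_upper hM hN) (add_comm n m ▸ mul_mem_upper hN hM)

/-- The matrix with superdiagonal `(a, b, c)`. -/
def superdiag (a b c : K) : Matrix (Fin 4) (Fin 4) K :=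
  !![0, a, 0, 0; 0, 0, b, 0; 0, 0, 0, c; 0, 0, 0, 0]

theorem superdiag_mem_upper (a b c : K) : superdiag a b c ∈ upper K 1 := by
  intro p q h
  fin_cases p <;> fin_cases q <;> simp_all [superdiag]

/-- The representation of the free Lie algebra by strictly upper triangular matrices that records
the coefficient of a word of length three. -/
def freeRep (a b c : X → K) : FreeLieAlgebra K X →ₗ⁅K⁆ Matrix (Fin 4) (Fin 4) K :=
  FreeLieAlgebra.lift K fun i => superdiag (a i) (b i) (c i)

theorem freeRep_mem_upper_one (a b c : X → K) (x : FreeLieAlgebra K X) :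
    freeRep a b c x ∈ upper K 1 := by
  let H : LieSubalgebra K (FreeLieAlgebra K X) :=
    { (upper K 1).comap (freeRep a b c : FreeLieAlgebra K X →ₗ[K] Matrix (Fin 4) (Fin 4) K) with
      lie_mem' := by
        intro x y hx hy
        change freeRep a b c ⁅x, y⁆ ∈ upper K 1
        rw [LieHom.map_lie]
        exact upper_antitone (by norm_num) (lie_mem_upper hx hy) }
  refine freeLie_mem_of_generators H (fun i => ?_) x
  change freeRep a b c _ ∈ upper K 1
  rw [freeRep, FreeLieAlgebra.lift_of_apply]
  exact superdiag_mem_upper _ _ _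

/-- Each further bracket moves one superdiagonal up. At `k = 3` nothing is left of a 4 × 4 matrix,
so the representation descends to class three. -/
theorem freeRep_mem_upper (a b c : X → K) (k : ℕ) (x : FreeLieAlgebra K X)
    (hx : x ∈ LieModule.lowerCentralSeries K (FreeLieAlgebra K X) (FreeLieAlgebra K X) k) :
    freeRep a b c x ∈ upper K (k + 1) := by
  induction k generalizing x with
  | zero => exact freeRep_mem_upper_one a b c x
  | succ k ih =>
    rw [LieModule.lowerCentralSeries_succ, ← LieSubmodule.mem_toSubmodule,
      LieSubmodule.lieIdeal_oper_eq_linear_span'] at hx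
    refine Submodule.span_induction (p := fun x _ => freeRep a b c x ∈ upper K (k + 1 + 1))
      ?_ ?_ ?_ ?_ hx
    · rintro _ ⟨y, -, z, hz, rfl⟩
      rw [LieHom.map_lie, add_comm (k + 1) 1]
      exact lie_mem_upper (freeRep_mem_upper_one a b c y) (ih z hz)
    · rw [map_zero]; exact zero_mem _
    · intro x y _ _ hx hy
      rw [map_add]; exact add_mem hx hy
    · intro t x _ hx
      rw [map_smul]; exact Submodule.smul_mem _ _ hx

end Representation

/-! ### Passage to the free-nilpotent quotient -/

section Quotient

attribute [local instance] LieRing.ofAssociativeRing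

variable {K : Type*} [Field K] {g : ℕ}

/-- The representation `freeRep`, on the free-nilpotent Lie algebra of class three. -/
def rep (a b c : Fin g → K) : FreeNilpotent K g 3 →ₗ[K] Matrix (Fin 4) (Fin 4) K :=
  Submodule.liftQ
    (LieModule.lowerCentralSeries K (FreeLieAlgebra K (Fin g)) (FreeLieAlgebra K (Fin g))
      3).toSubmodule
    (freeRep a b c : FreeLieAlgebra K (Fin g) →ₗ[K] Matrix (Fin 4) (Fin 4) K)
    fun x hx => eq_zero_of_mem_upper_four (freeRep_mem_upper a b c 3 x hx)

theorem rep_mk (a b c : Fin g → K) (x : FreeLieAlgebra K (Fin g)) :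
    rep a b c (LieSubmodule.Quotient.mk x : FreeNilpotent K g 3) = freeRep a b c x := rfl

theorem freeNilpotent_mk_surjective {c : ℕ} (y : FreeNilpotent K g c) :
    ∃ x : FreeLieAlgebra K (Fin g), (LieSubmodule.Quotient.mk x : FreeNilpotent K g c) = y :=
  LieSubmodule.Quotient.surjective_mk' _ y

theorem rep_lie (a b c : Fin g → K) (x y : FreeNilpotent K g 3) :
    rep a b c ⁅x, y⁆ = rep a b c x * rep a b c y - rep a b c y * rep a b c x := by
  obtain ⟨x, rfl⟩ := freeNilpotent_mk_surjective x
  obtain ⟨y, rfl⟩ := freeNilpotent_mk_surjective y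
  rw [← LieSubmodule.Quotient.mk_bracket]
  simp only [rep_mk, LieHom.map_lie, Ring.lie_def]

theorem rep_gen (a b c : Fin g → K) (i : Fin g) :
    rep a b c (gen K g 3 i) = superdiag (a i) (b i) (c i) := by
  rw [gen, rep_mk, freeRep, FreeLieAlgebra.lift_of_apply]

theorem rep_apply_eq_zero (a b c : Fin g → K) (x : FreeNilpotent K g 3) {p q : Fin 4}
    (h : q ≤ p) : rep a b c x p q = 0 := by
  obtain ⟨x, rfl⟩ := freeNilpotent_mk_surjective x
  exact freeRep_mem_upper_one a b c x p q (by omega)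

theorem rep_lie_zero_two (a b c : Fin g → K) (i : Fin g) (y : FreeNilpotent K g 3) :
    rep a b c ⁅gen K g 3 i, y⁆ 0 2 = a i * rep a b c y 1 2 - b i * rep a b c y 0 1 := by
  rw [rep_lie, rep_gen, Matrix.sub_apply, Matrix.mul_apply, Matrix.mul_apply]
  simp [Fin.sum_univ_four, superdiag, mul_comm]

theorem rep_lie_one_three (a b c : Fin g → K) (i : Fin g) (y : FreeNilpotent K g 3) :
    rep a b c ⁅gen K g 3 i, y⁆ 1 3 = b i * rep a b c y 2 3 - c i * rep a b c y 1 2 := by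
  rw [rep_lie, rep_gen, Matrix.sub_apply, Matrix.mul_apply, Matrix.mul_apply]
  simp [Fin.sum_univ_four, superdiag, mul_comm]

theorem rep_lie_zero_three (a b c : Fin g → K) (i : Fin g) (y : FreeNilpotent K g 3) :
    rep a b c ⁅gen K g 3 i, y⁆ 0 3 = a i * rep a b c y 1 3 - c i * rep a b c y 0 2 := by
  rw [rep_lie, rep_gen, Matrix.sub_apply, Matrix.mul_apply, Matrix.mul_apply]
  simp [Fin.sum_univ_four, superdiag, mul_comm]

theorem rep_lie_zero_one (a b c : Fin g → K) (x y : FreeNilpotent K g 3) :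
    rep a b c ⁅x, y⁆ 0 1 = 0 := by
  simp [rep_lie, Matrix.mul_apply, Fin.sum_univ_four, rep_apply_eq_zero]

theorem rep_lie_one_two (a b c : Fin g → K) (x y : FreeNilpotent K g 3) :
    rep a b c ⁅x, y⁆ 1 2 = 0 := by
  simp [rep_lie, Matrix.mul_apply, Fin.sum_univ_four, rep_apply_eq_zero]

/-- All brackets of length four vanish in a free-nilpotent Lie algebra of class three. -/
theorem lie_lie_lie_eq_zero (w x y z : FreeNilpotent K g 3) : ⁅w, ⁅x, ⁅y, z⁆⁆⁆ = 0 := by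
  obtain ⟨w, rfl⟩ := freeNilpotent_mk_surjective w
  obtain ⟨x, rfl⟩ := freeNilpotent_mk_surjective x
  obtain ⟨y, rfl⟩ := freeNilpotent_mk_surjective y
  obtain ⟨z, rfl⟩ := freeNilpotent_mk_surjective z
  simp only [← LieSubmodule.Quotient.mk_bracket]
  rw [LieSubmodule.Quotient.mk_eq_zero']
  simp only [LieModule.lowerCentralSeries_succ, LieModule.lowerCentralSeries_zero]
  exact LieSubmodule.lie_mem_lie (LieSubmodule.mem_top _) (LieSubmodule.lie_mem_lie
    (LieSubmodule.mem_top _) (LieSubmodule.lie_mem_lie (LieSubmodule.mem_top _)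
      (LieSubmodule.mem_top _)))

theorem lie_lie_lie_lie_eq_zero (w x y z : FreeNilpotent K g 3) : ⁅⁅w, x⁆, ⁅y, z⁆⁆ = 0 := by
  rw [lie_lie, lie_lie_lie_eq_zero, lie_lie_lie_eq_zero, sub_zero]

theorem mem_of_generators {c : ℕ} (H : LieSubalgebra K (FreeNilpotent K g c))
    (h : ∀ i, gen K g c i ∈ H) (x : FreeNilpotent K g c) : x ∈ H := by
  obtain ⟨x, rfl⟩ := freeNilpotent_mk_surjective x
  let H' : LieSubalgebra K (FreeLieAlgebra K (Fin g)) :=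
    { H.toSubmodule.comap (LieSubmodule.Quotient.mk' (LieModule.lowerCentralSeries K
        (FreeLieAlgebra K (Fin g)) (FreeLieAlgebra K (Fin g)) c) :
          FreeLieAlgebra K (Fin g) →ₗ[K] FreeNilpotent K g c) with
      lie_mem' := fun {x y} hx hy => H.lie_mem hx hy }
  exact freeLie_mem_of_generators H' h x

end Quotient

/-! ### Counting Hall elements -/

section HallIndex

/-- Indices `k > j` of the brackets `[x_j, x_k]` in the Hall basis. -/
abbrev PairIndex (g : ℕ) := Σ k : Fin g, Set.Iio k

/-- Indices `k > j`, `k ≥ i` of the brackets `[x_i, [x_j, x_k]]` in the Hall basis. -/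
abbrev TripleIndex (g : ℕ) := Σ k : Fin g, Set.Iio k × Set.Iic k

/-- Indices of the Hall basis of the free-nilpotent Lie algebra of class three. -/
abbrev HallIndex (g : ℕ) := Fin g ⊕ PairIndex g ⊕ TripleIndex g

theorem card_pairIndex (g : ℕ) : Fintype.card (PairIndex g) = g.choose 2 := by
  rw [Fintype.card_sigma]
  simp [Fin.sum_univ_eq_sum_range (fun k => k), Finset.sum_range_id, Nat.choose_two_right]

/-- With `k` counted from 0 there are `k` choices of `j < k` and `k + 1` of `i ≤ k`; the sum of `k
(k + 1)` telescopes through cubes. -/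
theorem three_mul_card_tripleIndex (g : ℕ) : 3 * Fintype.card (TripleIndex g) + g = g ^ 3 := by
  have h : Fintype.card (TripleIndex g) = ∑ k ∈ Finset.range g, k * (k + 1) := by
    rw [Fintype.card_sigma, ← Fin.sum_univ_eq_sum_range (fun k => k * (k + 1))]
    simp
  rw [h]
  clear h
  induction g with
  | zero => rfl
  | succ n ih =>
    rw [Finset.sum_range_succ]
    linarith [ih, (by ring : (n + 1) ^ 3 = n ^ 3 + 3 * (n * (n + 1)) + 1)]

end HallIndex

/-! ### Hall elements span -/

section Hall

variable {K L : Type*} [Field K] [LieRing L] [LieAlgebra K L] {g : ℕ} (x : Fin g → L)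

/-- The Hall elements of degree at most three in a family of elements of a Lie algebra. -/
def hall : HallIndex g → L :=
  Sum.elim x (Sum.elim (fun p => ⁅x p.2, x p.1⁆) fun t => ⁅x t.2.2, ⁅x t.2.1, x t.1⁆⁆)

theorem mem_span_hall (i : Fin g) : x i ∈ Submodule.span K (Set.range (hall x)) :=
  Submodule.subset_span ⟨Sum.inl i, rfl⟩

theorem lie_mem_span_hall (j k : Fin g) :
    ⁅x j, x k⁆ ∈ Submodule.span K (Set.range (hall x)) := by
  rcases lt_trichotomy j k with h | rfl | h
  · exact Submodule.subset_span ⟨Sum.inr (Sum.inl ⟨k, j, h⟩), rfl⟩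
  · rw [lie_self]; exact zero_mem _
  · rw [← lie_skew]
    exact neg_mem (Submodule.subset_span ⟨Sum.inr (Sum.inl ⟨j, k, h⟩), rfl⟩)

/-- The Jacobi identity, in the form that rewrites a bracket in terms of the Hall basis. -/
theorem lie_lie_eq_sub {L : Type*} [LieRing L] (x y z : L) : ⁅x, ⁅y, z⁆⁆ = ⁅z, ⁅y, x⁆⁆ - ⁅y, ⁅z, x⁆⁆ := by
  rw [leibniz_lie x y z, ← lie_skew z ⁅y, x⁆, ← lie_skew x y, ← lie_skew z x, neg_lie, lie_neg,
    sub_neg_eq_add]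

/-- When the outer index exceeds both inner ones, Jacobi moves it to the innermost place, leaving
two Hall elements. -/
theorem lie_lie_mem_span_hall (i j k : Fin g) :
    ⁅x i, ⁅x j, x k⁆⁆ ∈ Submodule.span K (Set.range (hall x)) := by
  have basic : ∀ {i j k : Fin g}, j < k → i ≤ k →
      ⁅x i, ⁅x j, x k⁆⁆ ∈ Submodule.span K (Set.range (hall x)) :=
    fun {i j k} hj hi => Submodule.subset_span ⟨Sum.inr (Sum.inr ⟨k, ⟨j, hj⟩, ⟨i, hi⟩⟩), rfl⟩
  have lt : ∀ {i j k : Fin g}, j < k →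
      ⁅x i, ⁅x j, x k⁆⁆ ∈ Submodule.span K (Set.range (hall x)) := by
    intro i j k hj
    rcases le_or_gt i k with hi | hi
    · exact basic hj hi
    · rw [lie_lie_eq_sub]
      exact sub_mem (basic (hj.trans hi) hi.le) (basic hi (hj.trans hi).le)
  rcases lt_trichotomy j k with h | rfl | h
  · exact lt h
  · rw [lie_self, lie_zero]; exact zero_mem _
  · rw [← lie_skew (x j), lie_neg]
    exact neg_mem (lt h)

/-- The span is stable under bracketing with generators, since degree-three elements are sent to
zero. Generation is then used twice: to make the span an ideal, and to make it everything. -/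
theorem span_hall (hx : ∀ H : LieSubalgebra K L, (∀ i, x i ∈ H) → ∀ y, y ∈ H)
    (hL : ∀ a b c d : L, ⁅a, ⁅b, ⁅c, d⁆⁆⁆ = 0) :
    Submodule.span K (Set.range (hall x)) = ⊤ := by
  set S := Submodule.span K (Set.range (hall x))
  have hgen : ∀ (i : Fin g), ∀ s ∈ S, ⁅x i, s⁆ ∈ S := by
    intro i s hs
    refine Submodule.span_induction (p := fun s _ => ⁅x i, s⁆ ∈ S) ?_ ?_ ?_ ?_ hs
    · rintro _ ⟨q | p | t, rfl⟩
      · exact lie_mem_span_hall _ _ _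
      · exact lie_lie_mem_span_hall _ _ _ _
      · simp only [hall, Sum.elim_inr, hL]
        exact zero_mem _
    · rw [lie_zero]; exact zero_mem _
    · intro a b _ _ ha hb
      rw [lie_add]; exact add_mem ha hb
    · intro t a _ ha
      rw [lie_smul]; exact S.smul_mem _ ha
  let N : LieSubalgebra K L :=
    { carrier := {y | ∀ s ∈ S, ⁅y, s⁆ ∈ S}
      zero_mem' := fun s _ => by rw [zero_lie]; exact zero_mem _
      add_mem' := fun ha hb s hs => by rw [add_lie]; exact add_mem (ha s hs) (hb s hs)
      smul_mem' := fun c a ha s hs => by rw [smul_lie]; exact S.smul_mem _ (ha s hs)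
      lie_mem' := fun ha hb s hs => by
        rw [lie_lie]; exact sub_mem (ha _ (hb s hs)) (hb _ (ha s hs)) }
  let H : LieSubalgebra K L :=
    { S with lie_mem' := fun {a b} _ hb => hx N hgen a b hb }
  exact eq_top_iff.2 fun y _ => hx H (mem_span_hall x) y

end Hall

/-! ### Linear independence and the Hall basis -/

section HallBasis

variable {K : Type*} [Field K] {g : ℕ}

variable (K) in
/-- Matrix coefficients dual to the Hall basis, up to nonzero scalars. -/
def hallDual : HallIndex g → Dual K (FreeNilpotent K g 3) :=
  -- The entry read here does not see the superdiagonals past the first one (past the second for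
  -- pairs). The all-ones choice for the next one makes the entry recoverable from a bracket with a
  -- generator, which the computation of the center uses.
  Sum.elim (fun q => Matrix.entryLinearMap K K 0 1 ∘ₗ rep (Pi.single q 1) 1 0)
    (Sum.elim
      (fun p => Matrix.entryLinearMap K K 0 2 ∘ₗ
        rep (Pi.single (p.2 : Fin g) 1) (Pi.single p.1 1) 1)
      fun t => Matrix.entryLinearMap K K 0 3 ∘ₗ
        rep (Pi.single t.1 1) (Pi.single (t.2.1 : Fin g) 1) (Pi.single (t.2.2 : Fin g) 1))

theorem hallDual_inl (q : Fin g) (z : FreeNilpotent K g 3) :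
    hallDual K (Sum.inl q) z = rep (Pi.single q 1) 1 0 z 0 1 := rfl

theorem hallDual_pair (k : Fin g) (j : Set.Iio k) (z : FreeNilpotent K g 3) :
    hallDual K (Sum.inr (Sum.inl ⟨k, j⟩)) z =
      rep (Pi.single (j : Fin g) 1) (Pi.single k 1) 1 z 0 2 := rfl

theorem hallDual_triple (k : Fin g) (j : Set.Iio k) (i : Set.Iic k) (z : FreeNilpotent K g 3) :
    hallDual K (Sum.inr (Sum.inr ⟨k, j, i⟩)) z =
      rep (Pi.single k 1) (Pi.single (j : Fin g) 1) (Pi.single (i : Fin g) 1) z 0 3 := rfl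

theorem hallDual_inl_lie (q : Fin g) (x y : FreeNilpotent K g 3) :
    hallDual K (Sum.inl q) ⁅x, y⁆ = 0 := rep_lie_zero_one _ _ _ _ _

theorem hallDual_inl_gen (q i : Fin g) :
    hallDual K (Sum.inl q) (gen K g 3 i) = if i = q then 1 else 0 := by
  rw [hallDual_inl, rep_gen]
  simp [superdiag, Pi.single_apply]

theorem rep_lie_gen_gen_zero_two (a b c : Fin g → K) (j k : Fin g) :
    rep a b c ⁅gen K g 3 j, gen K g 3 k⁆ 0 2 = a j * b k - b j * a k := by
  rw [rep_lie_zero_two, rep_gen]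
  simp [superdiag]

theorem rep_lie_lie_gen_zero_three (a b c : Fin g → K) (i j k : Fin g) :
    rep a b c ⁅gen K g 3 i, ⁅gen K g 3 j, gen K g 3 k⁆⁆ 0 3 =
      a i * (b j * c k - c j * b k) - c i * (a j * b k - b j * a k) := by
  rw [rep_lie_zero_three, rep_lie_one_three, rep_lie_gen_gen_zero_two, rep_gen]
  simp [superdiag]

/-- In degree three the functional extracts the coefficient of the word x_k x_j x_i. Expanding
[x_i', [x_j', x_k']] gives the words i'j'k', i'k'j', j'k'i', k'j'i'; given j < k, i ≤ k and the same
for the primed indices, a match forces equal triples. -/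
theorem hallDual_hall_of_ne {s t : HallIndex g} (h : s ≠ t) : hallDual K s (hall (gen K g 3) t) = 0 := by
  obtain q | ⟨k, j, hj⟩ | ⟨k, ⟨j, hj⟩, ⟨i, hi⟩⟩ := s <;>
    obtain q' | ⟨k', j', hj'⟩ | ⟨k', ⟨j', hj'⟩, ⟨i', hi'⟩⟩ := t
  · rw [hall, Sum.elim_inl, hallDual_inl_gen, if_neg]
    rintro rfl
    exact h rfl
  · exact hallDual_inl_lie _ _ _
  · exact hallDual_inl_lie _ _ _
  · simp [hallDual_pair, hall, rep_gen, superdiag]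
  · simp only [hallDual_pair, hall, Sum.elim_inr, Sum.elim_inl, rep_lie_gen_gen_zero_two,
      Pi.single_apply]
    by_cases h1 : k' = k
    · subst h1
      have h2 : j' ≠ j := by
        rintro rfl
        exact h rfl
      simp [h2, (Set.mem_Iio.1 hj').ne]
    · by_cases h3 : j' = k
      · subst h3
        have : k' ≠ j := (lt_trans (Set.mem_Iio.1 hj) (Set.mem_Iio.1 hj')).ne'
        simp [h1, this]
      · simp [h1, h3]
  · simp [hallDual_pair, hall, rep_lie_zero_two, rep_lie_one_two, rep_lie_zero_one]
  · simp [hallDual_triple, hall, rep_gen, superdiag]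
  · simp only [hallDual_triple, hall, Sum.elim_inr, Sum.elim_inl, rep_lie_zero_three]
    simp [rep_gen, superdiag]
  · simp only [hallDual_triple, hall, Sum.elim_inr, rep_lie_lie_gen_zero_three,
      Pi.single_apply]
    have h1 := Set.mem_Iio.1 hj
    have h2 := Set.mem_Iio.1 hj'
    have h3 := Set.mem_Iic.1 hi
    have h4 := Set.mem_Iic.1 hi'
    have h5 : ¬ (k' = k ∧ j' = j ∧ i' = i) := by
      rintro ⟨rfl, rfl, rfl⟩
      exact h rfl
    clear h hj hj' hi hi'
    split_ifs <;> first | omega | simp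

/-- The value is 1, except in degree three with i = k: there the word occurs twice and the value is
2. -/
theorem hallDual_hall_self_ne_zero [CharZero K] (s : HallIndex g) :
    hallDual K s (hall (gen K g 3) s) ≠ 0 := by
  obtain q | ⟨k, j, hj⟩ | ⟨k, ⟨j, hj⟩, ⟨i, hi⟩⟩ := s
  · simp [hall, hallDual_inl_gen]
  · simp [hallDual_pair, hall, rep_lie_gen_gen_zero_two, (Set.mem_Iio.1 hj).ne]
  · simp only [hallDual_triple, hall, Sum.elim_inr, rep_lie_lie_gen_zero_three,
      Pi.single_apply]
    by_cases h : i = k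
    · subst h
      norm_num [(Set.mem_Iio.1 hj).ne, (Set.mem_Iio.1 hj).ne']
    · simp [h, (Set.mem_Iio.1 hj).ne, (Set.mem_Iio.1 hj).ne']

theorem linearIndependent_hall [CharZero K] :
    LinearIndependent K (hall (gen K g 3)) := by
  refine LinearIndependent.of_pairwise_dual_eq_zero_one _
    (fun s => (hallDual K s (hall (gen K g 3) s))⁻¹ • hallDual K s) (fun s t h => ?_) fun s => ?_
  · simp [hallDual_hall_of_ne h]
  · simp [hallDual_hall_self_ne_zero]

variable (K g) in
/-- The Hall basis of the free-nilpotent Lie algebra of class three. -/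
def hallBasis [CharZero K] : Basis (HallIndex g) K (FreeNilpotent K g 3) :=
  Basis.mk linearIndependent_hall
    (span_hall (gen K g 3) mem_of_generators lie_lie_lie_eq_zero).ge

theorem hallBasis_apply [CharZero K] (s : HallIndex g) : hallBasis K g s = hall (gen K g 3) s :=
  Basis.mk_apply _ _ _

theorem hallDual_apply [CharZero K] (s : HallIndex g) (z : FreeNilpotent K g 3) :
    hallDual K s z = (hallBasis K g).repr z s * hallDual K s (hall (gen K g 3) s) := by
  conv_lhs => rw [← (hallBasis K g).sum_repr z]
  rw [map_sum, Finset.sum_eq_single s]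
  · rw [map_smul, hallBasis_apply, smul_eq_mul]
  · intro t _ h
    rw [map_smul, hallBasis_apply, hallDual_hall_of_ne h.symm, smul_zero]
  · simp

theorem hallDual_eq_zero_iff [CharZero K] (s : HallIndex g) (z : FreeNilpotent K g 3) :
    hallDual K s z = 0 ↔ (hallBasis K g).repr z s = 0 := by
  rw [hallDual_apply, mul_eq_zero, or_iff_left (hallDual_hall_self_ne_zero s)]

theorem finrank_freeNilpotent_three [CharZero K] :
    finrank K (FreeNilpotent K g 3) = g + (g.choose 2 + Fintype.card (TripleIndex g)) := by
  rw [finrank_eq_card_basis (hallBasis K g), Fintype.card_sum, Fintype.card_sum, Fintype.card_fin,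
    card_pairIndex]

end HallBasis

/-! ### The center -/

section Center

variable {K : Type*} [Field K] {g : ℕ}

/-- Bracketing with a generator whose entry in the first superdiagonal is 0 returns the wanted
matrix entry up to sign. In degree one this needs a generator other than `x_q`; in degree two `x_k`
serves, as j ≠ k. -/
theorem hallDual_eq_zero_of_mem_center (hg : 2 ≤ g) {z : FreeNilpotent K g 3}
    (hz : ∀ x : FreeNilpotent K g 3, ⁅x, z⁆ = 0) (s : Fin g ⊕ PairIndex g) :
    hallDual K (Sum.elim Sum.inl (Sum.inr ∘ Sum.inl) s) z = 0 := by
  obtain q | ⟨k, j, hj⟩ := s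
  · have : Nontrivial (Fin g) := Fin.nontrivial_iff_two_le.2 hg
    obtain ⟨i, hi⟩ := exists_ne q
    have h := rep_lie_zero_two (Pi.single q 1) 1 0 i z
    rw [hz, map_zero, Pi.single_eq_of_ne hi] at h
    simpa [hallDual_inl] using h
  · have h := rep_lie_zero_three (Pi.single (j : Fin g) 1) (Pi.single k 1) 1 k z
    rw [hz, map_zero, Pi.single_eq_of_ne (ne_of_gt hj)] at h
    simpa [hallDual_pair] using h

variable [CharZero K]

theorem center_freeNilpotent_three (hg : 2 ≤ g) :
    (LieAlgebra.center K (FreeNilpotent K g 3)).toSubmodule =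
      Submodule.span K (Set.range fun t : TripleIndex g => hall (gen K g 3) (Sum.inr (Sum.inr t))) := by
  apply le_antisymm
  · intro z hz
    have hz' : ∀ x : FreeNilpotent K g 3, ⁅x, z⁆ = 0 := hz
    rw [← (hallBasis K g).sum_repr z, Fintype.sum_sum_type, Fintype.sum_sum_type]
    have h := hallDual_eq_zero_of_mem_center hg hz'
    rw [Finset.sum_eq_zero, Finset.sum_eq_zero, zero_add, zero_add]
    · refine Submodule.sum_mem _ fun t _ => Submodule.smul_mem _ _ ?_
      rw [hallBasis_apply]
      exact Submodule.subset_span ⟨t, rfl⟩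
    · intro p _
      exact smul_eq_zero_of_left ((hallDual_eq_zero_iff _ _).1 (h (Sum.inr p))) _
    · intro q _
      exact smul_eq_zero_of_left ((hallDual_eq_zero_iff _ _).1 (h (Sum.inl q))) _
  · rw [Submodule.span_le]
    rintro _ ⟨t, rfl⟩
    exact fun x => lie_lie_lie_eq_zero _ _ _ _

theorem finrank_center_freeNilpotent_three (hg : 2 ≤ g) :
    finrank K (LieAlgebra.center K (FreeNilpotent K g 3)) = Fintype.card (TripleIndex g) := by
  change finrank K (LieAlgebra.center K (FreeNilpotent K g 3)).toSubmodule = _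
  rw [center_freeNilpotent_three hg]
  exact finrank_span_eq_card (linearIndependent_hall.comp _
    (Sum.inr_injective.comp Sum.inr_injective))

end Center

/-! ### Codimension of the radical -/

section Radical

variable {K L : Type*} [Field K] [LieRing L] [LieAlgebra K L] {g : ℕ}

/-- The linear map `z ↦ (v(z), (ℓ([x_i, z]))_i)`. -/
def radicalMap (x : Fin g → L) (v : L →ₗ[K] Fin g → K) (l : Dual K L) :
    L →ₗ[K] (Fin g → K) × (Fin g → K) :=
  v.prod (LinearMap.pi fun i => l ∘ₗ (LieAlgebra.ad K L (x i) : L →ₗ[K] L))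

theorem radicalMap_apply (x : Fin g → L) (v : L →ₗ[K] Fin g → K) (l : Dual K L) (z : L) :
    radicalMap x v l z = (v z, fun i => l ⁅x i, z⁆) := rfl

variable {x : Fin g → L} {v : L →ₗ[K] Fin g → K}
  (hx : ∀ H : LieSubalgebra K L, (∀ i, x i ∈ H) → ∀ y, y ∈ H)
  (hv : ∀ i, v (x i) = Pi.single i 1) (hv' : ∀ a b : L, v ⁅a, b⁆ = 0)
  (hL : ∀ a b c d : L, ⁅⁅a, b⁆, ⁅c, d⁆⁆ = 0)

include hx hv hv'

/-- The elements with such a decomposition form a Lie subalgebra, because `v` kills brackets. -/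
theorem exists_eq_add_sum (z : L) :
    ∃ d ∈ Submodule.span K (Set.range fun p : L × L => ⁅p.1, p.2⁆), z = d + ∑ i, v z i • x i := by
  let D := Submodule.span K (Set.range fun p : L × L => ⁅p.1, p.2⁆)
  let φ : L →ₗ[K] L :=
    LinearMap.id - ∑ i, ((LinearMap.proj i : (Fin g → K) →ₗ[K] K) ∘ₗ v).smulRight (x i)
  have hφ : ∀ z, φ z = z - ∑ i, v z i • x i := fun z => by simp [φ]
  let H : LieSubalgebra K L :=
    { D.comap φ with
      lie_mem' := by
        intro a b _ _
        change φ ⁅a, b⁆ ∈ D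
        rw [hφ, hv']
        simp only [Pi.zero_apply, zero_smul, Finset.sum_const_zero, sub_zero]
        exact Submodule.subset_span ⟨(a, b), rfl⟩ }
  have h : φ z ∈ D := by
    refine hx H (fun i => ?_) z
    change φ (x i) ∈ D
    simp [hφ, hv, Pi.single_apply]
  exact ⟨φ z, h, by rw [hφ, sub_add_cancel]⟩

omit hx hv hv'

include hL in
theorem lie_eq_zero_of_mem_span_lie {a b : L}
    (ha : a ∈ Submodule.span K (Set.range fun p : L × L => ⁅p.1, p.2⁆))
    (hb : b ∈ Submodule.span K (Set.range fun p : L × L => ⁅p.1, p.2⁆)) : ⁅a, b⁆ = 0 := by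
  induction ha, hb using Submodule.span_induction₂ with
  | mem_mem x y hx hy =>
    obtain ⟨p, rfl⟩ := hx
    obtain ⟨q, rfl⟩ := hy
    exact hL _ _ _ _
  | zero_left => exact zero_lie _
  | zero_right => exact lie_zero _
  | add_left _ _ _ _ _ _ h₁ h₂ => rw [add_lie, h₁, h₂, add_zero]
  | add_right _ _ _ _ _ _ h₁ h₂ => rw [lie_add, h₁, h₂, add_zero]
  | smul_left _ _ _ _ _ h => rw [smul_lie, h, smul_zero]
  | smul_right _ _ _ _ _ h => rw [lie_smul, h, smul_zero]

include hx hv hv' hL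

/-- An element with `v z = 0` is a sum of commutators, hence commutes with all commutators; only its
brackets with the generators remain to be tested. -/
theorem ker_radicalMap_le (l : Dual K L) :
    LinearMap.ker (radicalMap x v l) ≤ (radical l).toSubmodule := by
  intro z hz
  rw [LinearMap.mem_ker, radicalMap_apply, Prod.mk_eq_zero] at hz
  obtain ⟨d, hd, hzd⟩ := exists_eq_add_sum hx hv hv' z
  simp only [hz.1, Pi.zero_apply, zero_smul, Finset.sum_const_zero, add_zero] at hzd
  intro y
  obtain ⟨e, he, hy⟩ := exists_eq_add_sum hx hv hv' y
  rw [hy, add_lie, hzd, lie_eq_zero_of_mem_span_lie hL he hd, ← hzd, zero_add, sum_lie,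
    map_sum]
  refine Finset.sum_eq_zero fun i _ => ?_
  rw [smul_lie, map_smul, show l ⁅x i, z⁆ = 0 from congrFun hz.2 i, smul_zero]

theorem finrank_le_finrank_radical_add [FiniteDimensional K L] (l : Dual K L) :
    finrank K L ≤ finrank K (radical l) + 2 * g := by
  have h1 := LinearMap.finrank_range_add_finrank_ker (radicalMap x v l)
  have h2 : finrank K (LinearMap.ker (radicalMap x v l)) ≤ finrank K (radical l) :=
    Submodule.finrank_mono (ker_radicalMap_le hx hv hv' hL l)
  have h3 := Submodule.finrank_le (LinearMap.range (radicalMap x v l))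
  rw [finrank_prod, finrank_fin_fun] at h3
  omega

/-- Pairing `z` with [x_j, x_k] sees only the generator part of `z`, so `hl` applies to β = `v z`.
-/
theorem radical_le_ker_radicalMap {l : Dual K L}
    (hl : ∀ β : Fin g → K, (∀ j k, ∑ i, β i * l ⁅x i, ⁅x j, x k⁆⁆ = 0) → β = 0) :
    (radical l).toSubmodule ≤ LinearMap.ker (radicalMap x v l) := by
  intro z hz
  have hz' : ∀ y : L, l ⁅y, z⁆ = 0 := hz
  rw [LinearMap.mem_ker, radicalMap_apply, Prod.mk_eq_zero]
  refine ⟨hl _ fun j k => ?_, funext fun i => hz' _⟩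
  obtain ⟨d, hd, hzd⟩ := exists_eq_add_sum hx hv hv' z
  have h := hz' ⁅x j, x k⁆
  rw [hzd, lie_add, lie_eq_zero_of_mem_span_lie hL (Submodule.subset_span ⟨(x j, x k), rfl⟩) hd,
    zero_add, lie_sum, map_sum, ← neg_eq_zero, ← Finset.sum_neg_distrib] at h
  rw [← h]
  refine Finset.sum_congr rfl fun i _ => ?_
  rw [lie_smul, map_smul, ← lie_skew, map_neg, smul_eq_mul, mul_neg]

omit hx hL in
-- A functional vanishing on the range is tested on the [x_j, x_k], where `v` is zero and `hl` kills
-- its second half, and then on the x_i, which kills its first half.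
theorem range_radicalMap {l : Dual K L}
    (hl : ∀ β : Fin g → K, (∀ j k, ∑ i, β i * l ⁅x i, ⁅x j, x k⁆⁆ = 0) → β = 0) :
    LinearMap.range (radicalMap x v l) = ⊤ := by
  by_contra hne
  obtain ⟨f, hf, hle⟩ := Submodule.exists_le_ker_of_lt_top _ (lt_top_iff_ne_top.2 hne)
  have hf0 : ∀ z, f (v z, fun i => l ⁅x i, z⁆) = 0 := fun z => hle ⟨z, rfl⟩
  have hsplit : ∀ a b, f (a, b) = f (a, 0) + f (0, b) := fun a b => by simp [← map_add]
  have hsnd : ∀ b, f (0, b) = ∑ i, f (0, Pi.single i 1) * b i := by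
    intro b
    have := congrArg (f ∘ₗ LinearMap.inr K (Fin g → K) (Fin g → K)) (pi_eq_sum_univ' b)
    simpa [mul_comm, Pi.single_apply, ← Pi.single_apply] using this
  have hβ : (fun i => f (0, Pi.single i 1)) = 0 := by
    refine hl _ fun j k => ?_
    have h := hf0 ⁅x j, x k⁆
    rwa [hv', hsnd] at h
  have hsnd0 : ∀ b, f (0, b) = 0 := by
    intro b
    rw [hsnd]
    exact Finset.sum_eq_zero fun i _ => by rw [show f (0, Pi.single i 1) = 0 from congrFun hβ i,
      zero_mul]
  refine hf (LinearMap.prod_ext (LinearMap.pi_ext' fun i => LinearMap.ext_ring ?_)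
    (LinearMap.ext hsnd0))
  have h := hf0 (x i)
  rw [hsplit, hsnd0, add_zero, hv] at h
  exact h

theorem finrank_radical_add_eq [FiniteDimensional K L] {l : Dual K L}
    (hl : ∀ β : Fin g → K, (∀ j k, ∑ i, β i * l ⁅x i, ⁅x j, x k⁆⁆ = 0) → β = 0) :
    finrank K (radical l) + 2 * g = finrank K L := by
  have h1 := LinearMap.finrank_range_add_finrank_ker (radicalMap x v l)
  have h2 : finrank K (LinearMap.ker (radicalMap x v l)) = finrank K (radical l) := by
    rw [le_antisymm (ker_radicalMap_le hx hv hv' hL l) (radical_le_ker_radicalMap hx hv hv' hL hl)]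
    rfl
  rw [range_radicalMap hv hv' hl, finrank_top, finrank_prod, finrank_fin_fun] at h1
  omega

theorem index_eq_finrank_radical [FiniteDimensional K L] {l : Dual K L}
    (hl : ∀ β : Fin g → K, (∀ j k, ∑ i, β i * l ⁅x i, ⁅x j, x k⁆⁆ = 0) → β = 0) :
    finrank K (radical l) = index K L := by
  refine le_antisymm (le_csInf (Set.range_nonempty _) ?_) (Nat.sInf_le ⟨l, rfl⟩)
  rintro _ ⟨m, rfl⟩
  have h1 := finrank_le_finrank_radical_add hx hv hv' hL m
  have h2 := finrank_radical_add_eq hx hv hv' hL hl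
  change finrank K (radical l) ≤ finrank K (radical m)
  omega

end Radical

/-! ### The explicit linear form -/

section SpecialForm

variable {K : Type*} [Field K] [CharZero K] {g : ℕ}

/-- The rows of the matrix with entries `i + j + k` for `i ≤ k` and `0` otherwise, indexed by the
numbers `i` and the pairs `j < k` in `{1, …, g}`, are linearly independent. -/
theorem eq_zero_of_sum_mul_ite_eq_zero (hg : 3 ≤ g) (β : Fin g → K)
    (h : ∀ j k : Fin g, j < k → ∑ i : Fin g, β i *
      (if i ≤ k then (((i : ℕ) + 1 + ((j : ℕ) + 1) + ((k : ℕ) + 1) : ℕ) : K) else 0) = 0) :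
    β = 0 := by
  -- In terms of these partial sums, the equation for j < k is affine in j. For k ≥ 2 (counted from
  -- 0) two values of j are available, so both sums vanish.
  set s : Fin g → K := fun k => ∑ i : Fin g, if i ≤ k then β i else 0 with hs
  set t : Fin g → K := fun k => ∑ i : Fin g, if i ≤ k then β i * ((i : ℕ) + 1) else 0 with ht
  have hst : ∀ j k : Fin g, j < k → t k + s k * ((j : ℕ) + 1 + ((k : ℕ) + 1)) = 0 := by
    intro j k hjk
    rw [← h j k hjk, hs, ht]
    simp only [Finset.sum_mul, ← Finset.sum_add_distrib]
    refine Finset.sum_congr rfl fun i _ => ?_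
    split_ifs
    · push_cast; ring
    · simp
  have hs0 : ∀ k : Fin g, 2 ≤ (k : ℕ) → s k = 0 := by
    intro k hk
    have h0 := hst ⟨0, by omega⟩ k (Fin.lt_def.2 (by simp; omega))
    have h1 := hst ⟨1, by omega⟩ k (Fin.lt_def.2 (by simp; omega))
    push_cast at h0 h1
    linear_combination h1 - h0
  have ht0 : ∀ k : Fin g, 2 ≤ (k : ℕ) → t k = 0 := by
    intro k hk
    have h0 := hst ⟨0, by omega⟩ k (Fin.lt_def.2 (by simp; omega))
    rwa [hs0 k hk, zero_mul, add_zero] at h0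
  have sum_succ : ∀ (f : Fin g → K) (k k' : Fin g), (k' : ℕ) = k + 1 →
      (∑ i : Fin g, if i ≤ k' then f i else 0) = (∑ i : Fin g, if i ≤ k then f i else 0) + f k' := by
    intro f k k' hk
    rw [← Fintype.sum_ite_eq' k' f, ← Finset.sum_add_distrib]
    refine Finset.sum_congr rfl fun i _ => ?_
    simp only [Fin.le_def, Fin.ext_iff]
    split_ifs <;> first | omega | simp
  have sum_zero : ∀ (f : Fin g → K) (k : Fin g), (k : ℕ) = 0 →
      (∑ i : Fin g, if i ≤ k then f i else 0) = f k := by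
    intro f k hk
    rw [← Fintype.sum_ite_eq' k f]
    refine Finset.sum_congr rfl fun i _ => ?_
    simp only [Fin.le_def, Fin.ext_iff]
    split_ifs <;> first | omega | rfl
  -- Here `β k` is the difference of two consecutive vanishing partial sums.
  have h3 : ∀ k : Fin g, 3 ≤ (k : ℕ) → β k = 0 := by
    intro k hk
    have h := sum_succ β ⟨k - 1, by omega⟩ k (by simp only; omega)
    have h1 := hs0 k (by omega)
    have h2 := hs0 ⟨k - 1, by omega⟩ (by simp only; omega)
    simp only [hs] at h1 h2
    rw [h1, h2, zero_add] at h
    exact h.symm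
  set i₀ : Fin g := ⟨0, by omega⟩ with hi₀
  set i₁ : Fin g := ⟨1, by omega⟩ with hi₁
  set i₂ : Fin g := ⟨2, by omega⟩ with hi₂
  have hs₀ : s i₀ = β i₀ := sum_zero _ _ rfl
  have hs₁ : s i₁ = s i₀ + β i₁ := sum_succ _ _ _ rfl
  have hs₂ : s i₂ = s i₁ + β i₂ := sum_succ _ _ _ rfl
  have ht₀ : t i₀ = β i₀ * ((i₀ : ℕ) + 1) := sum_zero _ _ rfl
  have ht₁ : t i₁ = t i₀ + β i₁ * ((i₁ : ℕ) + 1) := sum_succ (fun i => β i * ((i : ℕ) + 1)) _ _ rfl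
  have ht₂ : t i₂ = t i₁ + β i₂ * ((i₂ : ℕ) + 1) := sum_succ (fun i => β i * ((i : ℕ) + 1)) _ _ rfl
  have e₁ := hst i₀ i₁ (Fin.lt_def.2 (by simp [hi₀, hi₁]))
  have e₂ := hs0 i₂ le_rfl
  have e₃ := ht0 i₂ le_rfl
  rw [ht₁, hs₁, ht₀, hs₀] at e₁
  rw [hs₂, hs₁, hs₀] at e₂
  rw [ht₂, ht₁, ht₀] at e₃
  simp only [hi₀, hi₁, hi₂] at e₁ e₂ e₃
  push_cast at e₁ e₂ e₃
  -- The three remaining equations are 4β₀ + 5β₁ = 0, β₀ + β₁ + β₂ = 0 and β₀ + 2β₁ + 3β₂ = 0, with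
  -- determinant -6, nonzero in characteristic zero.
  have b₀ : β i₀ = 0 := by
    have : (6 : K) * β i₀ = 0 := by linear_combination 15 * e₂ - 5 * e₃ - e₁
    simpa using this
  have b₁ : β i₁ = 0 := by linear_combination 3 * e₂ - e₃ - 2 * b₀
  have b₂ : β i₂ = 0 := by linear_combination e₂ - b₀ - b₁
  ext k
  rcases Nat.lt_or_ge k 3 with hk | hk
  · have : k = i₀ ∨ k = i₁ ∨ k = i₂ := by
      simp only [hi₀, hi₁, hi₂, Fin.ext_iff]
      omega
    rcases this with rfl | rfl | rfl
    exacts [b₀, b₁, b₂]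
  · exact h3 k hk

/-- The linear form on the free-nilpotent Lie algebra of class three that takes the value
`i + j + k` at the Hall element `[x_i, [x_j, x_k]]` and vanishes in degrees one and two. -/
def specialForm (K : Type*) [Field K] [CharZero K] (g : ℕ) : Dual K (FreeNilpotent K g 3) :=
  (hallBasis K g).constr K (Sum.elim 0 (Sum.elim 0 fun t =>
    ((((t.2.2 : Fin g) : ℕ) + 1 + (((t.2.1 : Fin g) : ℕ) + 1) + ((t.1 : ℕ) + 1) : ℕ) : K)))

theorem specialForm_gen (i : Fin g) : specialForm K g (gen K g 3 i) = 0 := by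
  have := (hallBasis K g).constr_basis K (Sum.elim 0 (Sum.elim 0 fun t =>
    ((((t.2.2 : Fin g) : ℕ) + 1 + (((t.2.1 : Fin g) : ℕ) + 1) + ((t.1 : ℕ) + 1) : ℕ) : K)))
    (Sum.inl i)
  rwa [hallBasis_apply] at this

theorem specialForm_lie_of_lt {j k : Fin g} (h : j < k) :
    specialForm K g ⁅gen K g 3 j, gen K g 3 k⁆ = 0 := by
  have := (hallBasis K g).constr_basis K (Sum.elim 0 (Sum.elim 0 fun t =>
    ((((t.2.2 : Fin g) : ℕ) + 1 + (((t.2.1 : Fin g) : ℕ) + 1) + ((t.1 : ℕ) + 1) : ℕ) : K)))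
    (Sum.inr (Sum.inl ⟨k, j, h⟩))
  rwa [hallBasis_apply] at this

theorem specialForm_lie (i j : Fin g) : specialForm K g ⁅gen K g 3 i, gen K g 3 j⁆ = 0 := by
  rcases lt_trichotomy i j with h | rfl | h
  · exact specialForm_lie_of_lt h
  · rw [lie_self, map_zero]
  · rw [← lie_skew, map_neg, specialForm_lie_of_lt h, neg_zero]

theorem specialForm_lie_lie {i j k : Fin g} (hj : j < k) (hi : i ≤ k) :
    specialForm K g ⁅gen K g 3 i, ⁅gen K g 3 j, gen K g 3 k⁆⁆ =
      (((i : ℕ) + 1 + ((j : ℕ) + 1) + ((k : ℕ) + 1) : ℕ) : K) := by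
  have := (hallBasis K g).constr_basis K (Sum.elim 0 (Sum.elim 0 fun t =>
    ((((t.2.2 : Fin g) : ℕ) + 1 + (((t.2.1 : Fin g) : ℕ) + 1) + ((t.1 : ℕ) + 1) : ℕ) : K)))
    (Sum.inr (Sum.inr ⟨k, ⟨j, hj⟩, ⟨i, hi⟩⟩))
  rwa [hallBasis_apply] at this

/-- Jacobi writes the element as a difference of two Hall elements with the same three indices; i +
j + k is symmetric, so the values cancel. -/
theorem specialForm_lie_lie_of_lt {i j k : Fin g} (hj : j < k) (hi : k < i) :
    specialForm K g ⁅gen K g 3 i, ⁅gen K g 3 j, gen K g 3 k⁆⁆ = 0 := by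
  rw [lie_lie_eq_sub, map_sub, specialForm_lie_lie (hj.trans hi) hi.le,
    specialForm_lie_lie hi (hj.trans hi).le, sub_eq_zero]
  congr 1
  omega

theorem eq_zero_of_sum_mul_specialForm_eq_zero (hg : 3 ≤ g) (β : Fin g → K)
    (h : ∀ j k, ∑ i, β i * specialForm K g ⁅gen K g 3 i, ⁅gen K g 3 j, gen K g 3 k⁆⁆ = 0) :
    β = 0 := by
  refine eq_zero_of_sum_mul_ite_eq_zero hg β fun j k hjk => ?_
  refine (Finset.sum_congr rfl fun i _ => ?_).trans (h j k)
  split_ifs with hi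
  · rw [specialForm_lie_lie hjk hi]
  · rw [specialForm_lie_lie_of_lt hjk (not_le.1 hi)]

end SpecialForm

/-! ### Coordinates along the generators -/

section GenCoord

variable {K : Type*} [Field K] {g : ℕ}

variable (K g) in
/-- The coordinates with respect to the generators. -/
def genCoord : FreeNilpotent K g 3 →ₗ[K] Fin g → K :=
  LinearMap.pi fun q => hallDual K (Sum.inl q)

theorem genCoord_gen (i : Fin g) : genCoord K g (gen K g 3 i) = Pi.single i 1 := by
  ext q
  exact (hallDual_inl_gen q i).trans (by simp [Pi.single_apply, eq_comm])

theorem genCoord_lie (x y : FreeNilpotent K g 3) : genCoord K g ⁅x, y⁆ = 0 :=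
  funext fun q => hallDual_inl_lie q x y

end GenCoord

end NilpotentIndex

end

/-! ### The index of the free-nilpotent Lie algebra of class three -/

theorem theorem3p4 (K : Type*) [Field K] [CharZero K] (g : ℕ) (hg : 3 ≤ g) :
    -- `F_{g,3}` is finite-dimensional, so that all dimensions below are genuine
    Module.Finite K (NilpotentIndex.FreeNilpotent K g 3) ∧
    -- the three formulas for the index
    (NilpotentIndex.index K (NilpotentIndex.FreeNilpotent K g 3) : ℚ) =
      (Module.finrank K (LieAlgebra.center K (NilpotentIndex.FreeNilpotent K g 3)) : ℚ)
        + (g.choose 2 : ℚ) - (g : ℚ) ∧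
    (NilpotentIndex.index K (NilpotentIndex.FreeNilpotent K g 3) : ℚ) =
      (Module.finrank K (NilpotentIndex.FreeNilpotent K g 3) : ℚ) - 2 * (g : ℚ) ∧
    (NilpotentIndex.index K (NilpotentIndex.FreeNilpotent K g 3) : ℚ) =
      (2 * (g : ℚ) ^ 3 + 3 * (g : ℚ) ^ 2 - 11 * (g : ℚ)) / 6 ∧
    -- the infimum is attained at the linear form which vanishes on the generators `x_i` and on the
    -- `[x_i, x_j]`, and takes the value `i + j + k` (numbering from `1`) at `[x_i, [x_j, x_k]]`
    -- for `j < k` and `i ≤ k`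
    ∃ l : Module.Dual K (NilpotentIndex.FreeNilpotent K g 3),
      (∀ i : Fin g, l (NilpotentIndex.gen K g 3 i) = 0) ∧
      (∀ i j : Fin g, l ⁅NilpotentIndex.gen K g 3 i, NilpotentIndex.gen K g 3 j⁆ = 0) ∧
      (∀ i j k : Fin g, j < k → i ≤ k →
        l ⁅NilpotentIndex.gen K g 3 i, ⁅NilpotentIndex.gen K g 3 j, NilpotentIndex.gen K g 3 k⁆⁆ =
          (((i : ℕ) + 1 + ((j : ℕ) + 1) + ((k : ℕ) + 1) : ℕ) : K)) ∧
      Module.finrank K (NilpotentIndex.radical l) =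
        NilpotentIndex.index K (NilpotentIndex.FreeNilpotent K g 3) := by
  have hfin : Module.Finite K (NilpotentIndex.FreeNilpotent K g 3) :=
    Module.Finite.of_basis (NilpotentIndex.hallBasis K g)
  have hl := NilpotentIndex.eq_zero_of_sum_mul_specialForm_eq_zero (K := K) hg
  have hindex := NilpotentIndex.index_eq_finrank_radical NilpotentIndex.mem_of_generators
    NilpotentIndex.genCoord_gen NilpotentIndex.genCoord_lie
    NilpotentIndex.lie_lie_lie_lie_eq_zero hl
  have hrad := NilpotentIndex.finrank_radical_add_eq NilpotentIndex.mem_of_generators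
    NilpotentIndex.genCoord_gen NilpotentIndex.genCoord_lie
    NilpotentIndex.lie_lie_lie_lie_eq_zero hl
  rw [hindex] at hrad
  have hdim := NilpotentIndex.finrank_freeNilpotent_three (K := K) (g := g)
  have hcenter := NilpotentIndex.finrank_center_freeNilpotent_three (K := K) (g := g) (by omega)
  have hcard := NilpotentIndex.three_mul_card_tripleIndex g
  have hchoose : (g.choose 2 : ℚ) = g * (g - 1) / 2 := Nat.cast_choose_two ℚ g
  have hradQ : (NilpotentIndex.index K (NilpotentIndex.FreeNilpotent K g 3) : ℚ) + 2 * g =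
      Module.finrank K (NilpotentIndex.FreeNilpotent K g 3) := mod_cast hrad
  have hdimQ : (Module.finrank K (NilpotentIndex.FreeNilpotent K g 3) : ℚ) =
      g + (g.choose 2 + Fintype.card (NilpotentIndex.TripleIndex g)) := mod_cast hdim
  have hcardQ : 3 * (Fintype.card (NilpotentIndex.TripleIndex g) : ℚ) + g = g ^ 3 :=
    mod_cast hcard
  rw [hchoose] at hdimQ
  refine ⟨hfin, ?_, ?_, ?_, NilpotentIndex.specialForm K g, NilpotentIndex.specialForm_gen,
    NilpotentIndex.specialForm_lie, fun i j k => NilpotentIndex.specialForm_lie_lie, hindex⟩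
  -- The Hall count is g + C(g, 2) + dim Z, so subtracting 2g leaves dim Z + C(g, 2) - g.
  · rw [hcenter, hchoose]
    linarith
  · linarith
  · linarith
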